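/- For an integer $m\ge 0$ let $$c_m^{(1)}:=\max\{|p'(0)| : p \text{ a real polynomial with } |p(t)|\le (1+|t|)^m \text{ for all } t\in\mathbb R\}.$$ For a real normed space $X$ let $$M_m^{(1)}(X):=\sup\{\|DP(x)\| : x\in X,\ \|x\|\le 1,\ P:X\to\mathbb R \text{ a continuous } m\text{-homogeneous polynomial with } \sup_{\|y\|\le 1}|P(y)|\le 1\},$$ where a continuous $m$-homogeneous polynomial is the diagonal restriction $x\mapsto L(x,\dots,x)$ of a bounded $m$-linear form $L$ on $X$, $DP(x)$ is the derivative of $P$ at $x$, and $\|DP(x)\|$ is its norm as a linear functional. Let $M_m^{(1)}:=\sup_X M_m^{(1)}(X)$ be the supremum over all real normed spaces $X$. Then for every $m\ge 0$ the maximum defining $c_m^{(1)}$ exists (it is finite and attained), and $M_m^{(1)}=c_m^{(1)}$. Moreover, there is an absolute constant $c_1>0$ such that for every integer $m\ge 2$ $$c_1\, m\log m\ \le\ c_m^{(1)}\ \le\ 3\,m\log m .$$ -/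

import Mathlib

open scoped ENNReal

universe u

/-- The values `|p'(0)|`, where `p` runs over the real polynomials with
`|p(t)| ≤ (1 + |t|)^m` for all real `t`. -/
def harrisValues (m : ℕ) : Set ℝ :=
  {r | ∃ p : Polynomial ℝ,
    (∀ t : ℝ, |p.eval t| ≤ (1 + |t|) ^ m) ∧ r = |p.derivative.eval 0|}

/-- The constant `c_m^{(1)}`, the maximum of `harrisValues m` (that the maximum exists is part of
the theorem). -/
noncomputable def harrisConst (m : ℕ) : ℝ := sSup (harrisValues m)

/-- `P : X → ℝ` is a continuous homogeneous polynomial of degree `m` on `X`: the restriction to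
the diagonal of a bounded `m`-linear form. -/
def IsHomogeneousPoly (m : ℕ) {X : Type*} [NormedAddCommGroup X] [NormedSpace ℝ X]
    (P : X → ℝ) : Prop :=
  ∃ L : ContinuousMultilinearMap ℝ (fun _ : Fin m => X) ℝ, ∀ x, P x = L (fun _ => x)

/-- The homogeneous Markov factor (of first order) of the real normed space `X`, that is, of the
unit ball of its norm: the supremum of `‖DP(x)‖` over `‖x‖ ≤ 1` and the continuous `m`-homogeneous
polynomials `P` with `sup_{‖y‖ ≤ 1} |P(y)| ≤ 1`. The values are extended nonnegative reals, so
that the supremum always makes sense. -/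
noncomputable def homogeneousMarkovFactor (m : ℕ) (X : Type*) [NormedAddCommGroup X]
    [NormedSpace ℝ X] : ℝ≥0∞ :=
  ⨆ (P : X → ℝ) (_ : IsHomogeneousPoly m P) (_ : ∀ y : X, ‖y‖ ≤ 1 → |P y| ≤ 1)
    (x : X) (_ : ‖x‖ ≤ 1), ENNReal.ofReal ‖fderiv ℝ P x‖

/-- The supremum of the homogeneous Markov factors over all norms, on all real vector spaces
(in an arbitrary universe). -/
noncomputable def homogeneousMarkovConst (m : ℕ) : ℝ≥0∞ :=
  ⨆ (X : Type u) (_ : NormedAddCommGroup X) (_ : NormedSpace ℝ X), homogeneousMarkovFactor m X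

/-! The constant exists by compactness: the growth bound forces degree at most `m`, and the
admissible coefficient vectors form a closed bounded set.

The two constants agree because `t ↦ P (x + t • y)`, for unit `y`, is admissible for `harrisValues`.
Conversely, in the `ℓ¹` plane `(1, t)` has norm `1 + |t|`, so homogenising an extremal polynomial
gives equality.

For the lower bound, the imaginary part `B` of `∏ (1 + i a_j t)` with `a_j = N/(j+1)` has `B'(0) = N
H_N`, of order `N log N`, while Euler's sine product bounds the modulus of the product by `(1 +
|t|)^m` once `5N ≤ m`.

For the upper bound, `(1+|x|)^(2m) ≤ (1+x)^(2m) + (1-x)^(2m) = 2 |h(x)|²`, where `h = ∏ (1 - i a_k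
z)`, `a_k = cot((2k+1)π/(4m))`, has all its zeros in the lower half-plane. A Bernstein inequality
with majorant `√2 |h|` (Phragmén–Lindelöf and Gauss–Lucas) gives `|p'(0)| ≤ √2 ∑ a_k`; then `cot θ ≤
1/θ` leaves a sum of odd reciprocals. -/

/-! ### Existence of the maximum -/

open Filter in
theorem Polynomial.natDegree_le_of_abs_eval_le {m : ℕ} {p : Polynomial ℝ}
    (hp : ∀ t : ℝ, |p.eval t| ≤ (1 + |t|) ^ m) : p.natDegree ≤ m := by
  by_contra! h
  have hQ : ((X + 1 : Polynomial ℝ) ^ m).Monic := by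
    simpa using (monic_X_add_C (1 : ℝ)).pow m
  have hdeg : ((X + 1 : Polynomial ℝ) ^ m).degree < p.degree := by
    have h1 : ((X + 1 : Polynomial ℝ) ^ m).natDegree = m := by
      have := natDegree_X_add_C (1 : ℝ)
      simp only [map_one] at this
      rw [natDegree_pow, this, mul_one]
    exact degree_lt_degree (by omega)
  have ht := abs_div_tendsto_atTop_atTop_of_degree_gt p _ hdeg hQ.ne_zero
  obtain ⟨t, ht1, ht0⟩ := ((ht.eventually_gt_atTop 1).and (eventually_ge_atTop 0)).exists
  have h2 := hp t
  rw [abs_of_nonneg ht0] at h2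
  have h3 : 0 < (1 + t) ^ m := by positivity
  rw [abs_div] at ht1
  simp only [eval_pow, eval_add, eval_X, eval_one] at ht1
  rw [add_comm t 1, abs_of_pos h3, lt_div_iff₀ h3] at ht1
  linarith

theorem Polynomial.eval_zero_derivative {R : Type*} [Semiring R] (p : Polynomial R) :
    p.derivative.eval 0 = p.coeff 1 := by
  rw [← coeff_zero_eq_eval_zero, coeff_derivative]; simp

/-- Coefficient vectors of the polynomials admissible in the definition of `harrisValues`. -/
def harrisCoeffs (m : ℕ) : Set (Fin (m + 1) → ℝ) :=
  {a | ∀ t : ℝ, |∑ i, a i * t ^ (i : ℕ)| ≤ (1 + |t|) ^ m}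

theorem isClosed_harrisCoeffs (m : ℕ) : IsClosed (harrisCoeffs m) := by
  simp only [harrisCoeffs, Set.ofPred_forall]
  exact isClosed_iInter fun t => isClosed_le (by fun_prop) continuous_const

/-- Interpolation at `0, …, m`: the Vandermonde matrix is invertible, so the values there, at most
`(1 + m)^m`, control the coefficients. -/
theorem isBounded_harrisCoeffs (m : ℕ) : Bornology.IsBounded (harrisCoeffs m) := by
  let V : Matrix (Fin (m + 1)) (Fin (m + 1)) ℝ := Matrix.vandermonde fun j => ((j : ℕ) : ℝ)
  have hV : IsUnit V := by
    rw [Matrix.isUnit_iff_isUnit_det, isUnit_iff_ne_zero, Matrix.det_vandermonde_ne_zero_iff]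
    intro i j hij
    exact Fin.ext (Nat.cast_injective hij)
  obtain ⟨K, -, hK⟩ := V.mulVecLin.exists_antilipschitzWith
    (LinearMap.ker_eq_bot.2 (Matrix.mulVec_injective_iff_isUnit.2 hV))
  refine isBounded_iff_forall_norm_le.2 ⟨K * (1 + m) ^ m, fun a ha => ?_⟩
  have h1 := ZeroHomClass.bound_of_antilipschitz V.mulVecLin hK a
  refine h1.trans (mul_le_mul_of_nonneg_left ?_ K.2)
  refine (pi_norm_le_iff_of_nonneg (by positivity)).2 fun j => ?_
  have h2 := ha ((j : ℕ) : ℝ)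
  have h3 : (((j : ℕ) : ℝ)) ≤ m := by exact_mod_cast Nat.lt_succ_iff.1 j.2
  rw [Nat.abs_cast] at h2
  have h4 : V.mulVecLin a j = ∑ i, a i * ((j : ℕ) : ℝ) ^ (i : ℕ) := by
    simp [V, Matrix.mulVec, dotProduct, Matrix.vandermonde_apply, mul_comm]
  rw [h4, Real.norm_eq_abs]
  exact h2.trans (by gcongr)

theorem harrisValues_eq_image (m : ℕ) : harrisValues m =
    -- The linear coefficient is written as a sum so that `m = 0`, where index `1` is missing, needs
    -- no separate case.
    (fun a : Fin (m + 1) → ℝ => |∑ i : Fin (m + 1), if (i : ℕ) = 1 then a i else 0|) '' harrisCoeffs m := by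
  ext r
  constructor
  · rintro ⟨p, hp, rfl⟩
    have hd := Polynomial.natDegree_le_of_abs_eval_le hp
    refine ⟨fun i => p.coeff i, fun t => ?_, ?_⟩
    · rw [Fin.sum_univ_eq_sum_range (fun i => p.coeff i * t ^ i),
        ← Polynomial.eval_eq_sum_range' (by omega)]
      exact hp t
    · rw [Polynomial.eval_zero_derivative]
      dsimp only
      rw [Fin.sum_univ_eq_sum_range (fun i => if i = 1 then p.coeff i else 0)]
      congr 1
      rw [Finset.sum_ite_eq' (Finset.range (m + 1)) 1 p.coeff]
      split_ifs with h
      · rfl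
      · rw [Polynomial.coeff_eq_zero_of_natDegree_lt]
        simp at h
        omega
  · rintro ⟨a, ha, rfl⟩
    refine ⟨∑ i : Fin (m + 1), Polynomial.C (a i) * Polynomial.X ^ (i : ℕ), fun t => ?_, ?_⟩
    · simpa [Polynomial.eval_finsetSum] using ha t
    · rw [Polynomial.eval_zero_derivative]
      simp [Polynomial.finsetSum_coeff, Polynomial.coeff_X_pow, eq_comm]

theorem isGreatest_harrisConst (m : ℕ) : IsGreatest (harrisValues m) (harrisConst m) := by
  have hc : IsCompact (harrisValues m) := by
    rw [harrisValues_eq_image]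
    refine (Metric.isCompact_of_isClosed_isBounded (isClosed_harrisCoeffs m)
      (isBounded_harrisCoeffs m)).image ?_
    refine (continuous_finsetSum _ fun i _ => ?_).abs
    split_ifs <;> fun_prop
  exact hc.isGreatest_sSup ⟨0, 0, fun t => by simp; positivity, by simp⟩

theorem Polynomial.abs_eval_zero_derivative_le_harrisConst {m : ℕ} {p : Polynomial ℝ}
    (hp : ∀ t : ℝ, |p.eval t| ≤ (1 + |t|) ^ m) : |p.derivative.eval 0| ≤ harrisConst m :=
  (isGreatest_harrisConst m).2 ⟨p, hp, rfl⟩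

theorem harrisConst_nonneg (m : ℕ) : 0 ≤ harrisConst m := by
  obtain ⟨p, -, h⟩ := (isGreatest_harrisConst m).1
  rw [h]
  positivity

/-! ### Upper bound for the Markov factor of any norm: restriction to lines -/

section
variable {X : Type*} [NormedAddCommGroup X] [NormedSpace ℝ X]

theorem IsHomogeneousPoly.differentiable {m : ℕ} {P : X → ℝ} (hP : IsHomogeneousPoly m P) :
    Differentiable ℝ P := by
  obtain ⟨L, hL⟩ := hP
  obtain rfl : P = fun x => L fun _ => x := funext hL
  intro x
  exact (L.hasFDerivAt (fun _ => x)).differentiableAt.comp x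
    (differentiableAt_pi.2 fun _ => differentiableAt_id)

theorem IsHomogeneousPoly.map_smul {m : ℕ} {P : X → ℝ} (hP : IsHomogeneousPoly m P) (c : ℝ)
    (x : X) : P (c • x) = c ^ m * P x := by
  obtain ⟨L, hL⟩ := hP
  rw [hL, hL, L.map_smul_univ (fun _ => c) fun _ => x]
  simp

theorem IsHomogeneousPoly.abs_le {m : ℕ} {P : X → ℝ} (hP : IsHomogeneousPoly m P)
    (h1 : ∀ y : X, ‖y‖ ≤ 1 → |P y| ≤ 1) {x : X} {r : ℝ} (hr : 0 < r) (hx : ‖x‖ ≤ r) :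
    |P x| ≤ r ^ m := by
  have h2 := h1 (r⁻¹ • x) (by
    rw [norm_smul, norm_inv, Real.norm_of_nonneg hr.le, inv_mul_le_iff₀ hr]
    linarith)
  have h3 : P x = r ^ m * P (r⁻¹ • x) := by
    rw [← hP.map_smul, smul_inv_smul₀ hr.ne']
  rw [h3, abs_mul, abs_of_pos (by positivity)]
  exact mul_le_of_le_one_right (by positivity) h2

theorem ContinuousMultilinearMap.exists_polynomial_eval_eq {ι : Type*} [Fintype ι]
    [DecidableEq ι] (L : ContinuousMultilinearMap ℝ (fun _ : ι => X) ℝ) (x y : X) :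
    ∃ p : Polynomial ℝ, ∀ t : ℝ, p.eval t = L fun _ => x + t • y := by
  refine ⟨∑ s : Finset ι, Polynomial.C (L (s.piecewise (fun _ => y) fun _ => x)) *
    Polynomial.X ^ s.card, fun t => ?_⟩
  have h1 : (fun _ : ι => x + t • y) = (fun _ => t • y) + fun _ => x := by
    ext; simp [add_comm]
  rw [h1, L.map_add_univ, Polynomial.eval_finsetSum]
  refine Finset.sum_congr rfl fun s _ => ?_
  have h2 : s.piecewise (fun _ => t • y) (fun _ => x) =
      fun i => (if i ∈ s then t else 1) • s.piecewise (fun _ => y) (fun _ => x) i := by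
    ext i
    by_cases hi : i ∈ s <;> simp [hi]
  rw [h2, L.map_smul_univ, Finset.prod_ite_mem, Finset.univ_inter, Finset.prod_const,
    Polynomial.eval_mul, Polynomial.eval_C, Polynomial.eval_pow, Polynomial.eval_X, smul_eq_mul,
    mul_comm]

theorem IsHomogeneousPoly.norm_fderiv_le {m : ℕ} {P : X → ℝ} (hP : IsHomogeneousPoly m P)
    (h1 : ∀ y : X, ‖y‖ ≤ 1 → |P y| ≤ 1) {x : X} (hx : ‖x‖ ≤ 1) :
    ‖fderiv ℝ P x‖ ≤ harrisConst m := by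
  refine ContinuousLinearMap.opNorm_le_of_unit_norm (harrisConst_nonneg m) fun y hy => ?_
  obtain ⟨L, hL⟩ := id hP
  obtain ⟨p, hp⟩ := L.exists_polynomial_eval_eq x y
  have hpt : ∀ t : ℝ, p.eval t = P (x + t • y) := fun t => by rw [hp, hL]
  have h2 : ∀ t : ℝ, |p.eval t| ≤ (1 + |t|) ^ m := fun t => by
    rw [hpt]
    refine hP.abs_le h1 (by positivity) ((norm_add_le _ _).trans ?_)
    rw [norm_smul, hy, Real.norm_eq_abs]
    linarith
  have h3 : HasDerivAt (fun t : ℝ => P (x + t • y)) (fderiv ℝ P x y) 0 := by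
    have h4 : HasDerivAt (fun t : ℝ => x + t • y) y 0 := by
      simpa using ((hasDerivAt_id (0 : ℝ)).smul_const y).const_add x
    have h5 : HasFDerivAt P (fderiv ℝ P x) (x + (0 : ℝ) • y) := by
      simpa using (hP.differentiable x).hasFDerivAt
    exact h5.comp_hasDerivAt 0 h4
  rw [← funext hpt] at h3
  rw [h3.unique (p.hasDerivAt 0), Real.norm_eq_abs]
  exact Polynomial.abs_eval_zero_derivative_le_harrisConst h2

theorem homogeneousMarkovFactor_le (m : ℕ) (X : Type*) [NormedAddCommGroup X] [NormedSpace ℝ X] :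
    homogeneousMarkovFactor m X ≤ ENNReal.ofReal (harrisConst m) :=
  iSup_le fun _ => iSup_le fun hP => iSup_le fun h1 => iSup_le fun _ => iSup_le fun hx =>
    ENNReal.ofReal_le_ofReal (hP.norm_fderiv_le h1 hx)

end

/-! ### Sharpness in the `ℓ¹` plane -/

/-- The plane with the `ℓ¹` norm, in an arbitrary universe. -/
abbrev L1Plane : Type u := PiLp 1 fun _ : ULift.{u} (Fin 2) => ℝ

namespace L1Plane

/-- The coordinates of the `ℓ¹` plane. -/
noncomputable def coord (i : Fin 2) : L1Plane.{u} →L[ℝ] ℝ := PiLp.proj 1 _ ⟨i⟩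

/-- The point with the coordinates `a`, `b`. -/
def mk (a b : ℝ) : L1Plane.{u} := WithLp.toLp 1 fun i => if i.down = 0 then a else b

@[simp] theorem coord_zero_mk (a b : ℝ) : coord.{u} 0 (mk a b) = a := by simp [coord, mk]

@[simp] theorem coord_one_mk (a b : ℝ) : coord.{u} 1 (mk a b) = b := by simp [coord, mk]

theorem norm_eq (x : L1Plane.{u}) : ‖x‖ = |coord 0 x| + |coord 1 x| := by
  rw [PiLp.norm_eq_of_L1, ← Equiv.ulift.symm.sum_comp]
  simp [coord]

theorem norm_mk (a b : ℝ) : ‖mk.{u} a b‖ = |a| + |b| := by simp [norm_eq]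

theorem mk_add_smul (t : ℝ) : mk.{u} 1 0 + t • mk 0 1 = mk 1 t := by
  ext i
  simp only [mk, PiLp.add_apply, PiLp.smul_apply]
  split_ifs <;> simp

/-- The homogenisation, of degree `m`, of a polynomial. -/
noncomputable def homogenize (m : ℕ) (p : Polynomial ℝ) (x : L1Plane.{u}) : ℝ :=
  ∑ i ∈ Finset.range (m + 1), p.coeff i * ((coord 0 x) ^ (m - i) * (coord 1 x) ^ i)

theorem homogenize_mk_one {m : ℕ} {p : Polynomial ℝ} (hd : p.natDegree ≤ m) (t : ℝ) :
    homogenize.{u} m p (mk 1 t) = p.eval t := by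
  rw [Polynomial.eval_eq_sum_range' (n := m + 1) (by omega)]
  simp [homogenize]

theorem isHomogeneousPoly_homogenize (m : ℕ) (p : Polynomial ℝ) :
    IsHomogeneousPoly m (homogenize.{u} m p) := by
  -- The form need not be symmetric: for the `i`-th monomial the first `i` slots take the second
  -- coordinate, the others the first.
  refine ⟨∑ i ∈ Finset.range (m + 1), p.coeff i •
    (ContinuousMultilinearMap.mkPiAlgebra ℝ (Fin m) ℝ).compContinuousLinearMap
      (fun j => if (j : ℕ) < i then coord 1 else coord 0), fun x => ?_⟩
  rw [_root_.sum_apply]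
  refine Finset.sum_congr rfl fun i hi => ?_
  have hi' : i ≤ m := by simpa [Nat.lt_succ_iff] using hi
  have h1 : ∀ j : Fin m, (if (j : ℕ) < i then coord.{u} 1 else coord 0) x =
      if (j : ℕ) < i then coord 1 x else coord 0 x := fun j => by split_ifs <;> rfl
  simp only [_root_.smul_apply,
    ContinuousMultilinearMap.compContinuousLinearMap_apply,
    ContinuousMultilinearMap.mkPiAlgebra_apply, smul_eq_mul, h1]
  congr 1
  rw [Fin.prod_univ_eq_prod_range (fun j => if j < i then coord 1 x else coord 0 x),
    ← Finset.prod_range_mul_prod_Ico _ hi',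
    Finset.prod_congr rfl (g := fun _ => coord 1 x) (fun j hj => if_pos (Finset.mem_range.1 hj)),
    Finset.prod_congr rfl (s₁ := Finset.Ico i m) (g := fun _ => coord 0 x)
      (fun j hj => if_neg (not_lt.2 (Finset.mem_Ico.1 hj).1))]
  simp [mul_comm]

theorem abs_homogenize_le {m : ℕ} {p : Polynomial ℝ}
    (hp : ∀ t : ℝ, |p.eval t| ≤ (1 + |t|) ^ m) (a b : ℝ) :
    |homogenize.{u} m p (mk a b)| ≤ (|a| + |b|) ^ m := by
  have key : ∀ a : ℝ, a ≠ 0 → |homogenize.{u} m p (mk a b)| ≤ (|a| + |b|) ^ m := by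
    intro a ha
    have h1 : mk.{u} a b = a • mk 1 (b / a) := by
      ext i
      simp only [mk, PiLp.smul_apply]
      split_ifs
      · simp
      · simp [mul_div_cancel₀ _ ha]
    rw [h1, (isHomogeneousPoly_homogenize m p).map_smul,
      homogenize_mk_one (Polynomial.natDegree_le_of_abs_eval_le hp), abs_mul, abs_pow]
    calc |a| ^ m * |p.eval (b / a)| ≤ |a| ^ m * (1 + |b / a|) ^ m := by gcongr; exact hp _
      _ = (|a| + |b|) ^ m := by
        rw [← mul_pow, abs_div, mul_add, mul_div_cancel₀ _ (abs_ne_zero.2 ha), mul_one]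
  -- The line `a = 0` is reached by continuity.
  have hcl : IsClosed {a : ℝ | |homogenize.{u} m p (mk a b)| ≤ (|a| + |b|) ^ m} := by
    simp only [homogenize, coord_zero_mk, coord_one_mk]
    exact isClosed_le (by fun_prop) (by fun_prop)
  have hsub : ({0}ᶜ : Set ℝ) ⊆ {a : ℝ | |homogenize.{u} m p (mk a b)| ≤ (|a| + |b|) ^ m} :=
    fun a ha => key a ha
  have := (dense_compl_singleton (0 : ℝ)).closure_eq ▸ hcl.closure_subset_iff.2 hsub
  exact this (Set.mem_univ a)

theorem mk_coord (x : L1Plane.{u}) : mk (coord 0 x) (coord 1 x) = x := by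
  ext ⟨i⟩
  fin_cases i <;> simp [mk, coord]

theorem harrisConst_le_homogeneousMarkovFactor (m : ℕ) :
    ENNReal.ofReal (harrisConst m) ≤ homogeneousMarkovFactor m L1Plane.{u} := by
  obtain ⟨p, hp, h⟩ := (isGreatest_harrisConst m).1
  have hP := isHomogeneousPoly_homogenize.{u} m p
  have h1 : ∀ y : L1Plane.{u}, ‖y‖ ≤ 1 → |homogenize m p y| ≤ 1 := fun y hy => by
    rw [← mk_coord y]
    refine (abs_homogenize_le hp _ _).trans ?_
    rw [← norm_eq]
    exact pow_le_one₀ (norm_nonneg _) hy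
  refine le_trans (ENNReal.ofReal_le_ofReal ?_) (le_iSup_of_le (homogenize m p) <|
    le_iSup_of_le hP <| le_iSup_of_le h1 <| le_iSup_of_le (mk 1 0) <|
    le_iSup_of_le (by simp [norm_mk]) le_rfl)
  have h3 : HasDerivAt (fun t : ℝ => homogenize m p (mk.{u} 1 0 + t • mk 0 1))
      (fderiv ℝ (homogenize m p) (mk.{u} 1 0) (mk 0 1)) 0 := by
    have h4 : HasDerivAt (fun t : ℝ => mk.{u} 1 0 + t • mk 0 1) (mk 0 1) 0 := by
      simpa using ((hasDerivAt_id (0 : ℝ)).smul_const (mk.{u} 0 1)).const_add (mk 1 0)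
    have h5 : HasFDerivAt (homogenize m p) (fderiv ℝ (homogenize m p) (mk.{u} 1 0))
        (mk 1 0 + (0 : ℝ) • mk 0 1) := by
      simpa using (hP.differentiable (mk 1 0)).hasFDerivAt
    exact h5.comp_hasDerivAt 0 h4
  simp only [mk_add_smul, homogenize_mk_one (Polynomial.natDegree_le_of_abs_eval_le hp)] at h3
  rw [h, (p.hasDerivAt 0).unique h3, ← Real.norm_eq_abs]
  exact ContinuousLinearMap.unit_le_opNorm _ _ (by simp [norm_mk])

end L1Plane

theorem homogeneousMarkovConst_eq (m : ℕ) :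
    homogeneousMarkovConst.{u} m = ENNReal.ofReal (harrisConst m) :=
  le_antisymm
    (iSup_le fun X => iSup_le fun _ => iSup_le fun _ => homogeneousMarkovFactor_le m X)
    ((L1Plane.harrisConst_le_homogeneousMarkovFactor m).trans <|
      le_iSup_of_le L1Plane.{u} <| le_iSup_of_le inferInstance <|
        le_iSup_of_le inferInstance le_rfl)

/-! ### Lower bound of order `m log m` -/

/-- The real and imaginary parts of the polynomial `∏ (1 + i a_j t)`. -/
theorem Polynomial.exists_sq_add_sq_eq_prod {ι : Type*} (s : Finset ι) (a : ι → ℝ) :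
    ∃ A B : Polynomial ℝ,
      (∀ t, A.eval t ^ 2 + B.eval t ^ 2 = ∏ j ∈ s, (1 + a j ^ 2 * t ^ 2)) ∧
      A.eval 0 = 1 ∧ B.derivative.eval 0 = ∑ j ∈ s, a j := by
  classical
  induction s using Finset.induction_on with
  | empty => exact ⟨1, 0, by simp, by simp, by simp⟩
  | insert j s hj ih =>
    obtain ⟨A, B, h1, h2, h3⟩ := ih
    -- Real and imaginary parts of `(A + iB)(1 + i a_j t)`.
    refine ⟨A - C (a j) * X * B, B + C (a j) * X * A, fun t => ?_, ?_, ?_⟩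
    · rw [Finset.prod_insert hj, ← h1]
      simp
      ring
    · simp [h2]
    · simp [h2, h3, Finset.sum_insert hj, add_comm]

-- By Euler's sine product at `ix`, the partial products increase to `sinh(πx)/(πx)`, and `sinh u ≤
-- u e^u` because `1 - e^(-2u) ≤ 2u`.
open Filter in
theorem Real.prod_one_add_sq_div_le_exp (N : ℕ) {x : ℝ} (hx : 0 ≤ x) :
    ∏ j ∈ Finset.range N, (1 + x ^ 2 / ((j : ℝ) + 1) ^ 2) ≤ exp (Real.pi * x) := by
  rcases hx.eq_or_lt with rfl | hx
  · simp
  have hpos : ∀ n : ℕ, 0 < ∏ j ∈ Finset.range n, (1 + x ^ 2 / ((j : ℝ) + 1) ^ 2) :=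
    fun n => Finset.prod_pos fun j _ => by positivity
  have hpx : 0 < Real.pi * x := by positivity
  have hmono : Monotone fun n : ℕ =>
      Real.pi * x * ∏ j ∈ Finset.range n, (1 + x ^ 2 / ((j : ℝ) + 1) ^ 2) := by
    refine monotone_nat_of_le_succ fun n => ?_
    rw [Finset.prod_range_succ]
    refine mul_le_mul_of_nonneg_left ?_ hpx.le
    exact le_mul_of_one_le_right (hpos n).le (le_add_of_nonneg_right (by positivity))
  have hlim : Tendsto (fun n : ℕ =>
      Real.pi * x * ∏ j ∈ Finset.range n, (1 + x ^ 2 / ((j : ℝ) + 1) ^ 2)) atTop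
      (nhds (sinh (Real.pi * x))) := by
    have h1 := (Complex.tendsto_euler_sin_prod (x * Complex.I)).norm
    have h2 : ‖Complex.sin (Real.pi * (x * Complex.I))‖ = sinh (Real.pi * x) := by
      rw [← mul_assoc, Complex.sin_mul_I, norm_mul, Complex.norm_I, mul_one]
      have : Complex.sinh (Real.pi * x) = ((sinh (Real.pi * x) : ℝ) : ℂ) := by push_cast; rfl
      rw [this, Complex.norm_real, norm_of_nonneg (sinh_nonneg_iff.2 hpx.le)]
    rw [h2] at h1
    refine h1.congr fun n => ?_
    have h3 : (∏ j ∈ Finset.range n, (1 - (x * Complex.I) ^ 2 / ((j : ℂ) + 1) ^ 2)) =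
        ((∏ j ∈ Finset.range n, (1 + x ^ 2 / ((j : ℝ) + 1) ^ 2) : ℝ) : ℂ) := by
      push_cast
      refine Finset.prod_congr rfl fun j _ => ?_
      rw [mul_pow, Complex.I_sq]
      ring
    rw [h3, norm_mul, Complex.norm_real, norm_of_nonneg (hpos n).le]
    simp [abs_of_pos hx, abs_of_pos Real.pi_pos]
  have h4 := hmono.ge_of_tendsto hlim N
  have h5 : sinh (Real.pi * x) ≤ Real.pi * x * exp (Real.pi * x) := by
    have h6 : 1 - 2 * (Real.pi * x) ≤ exp (-(Real.pi * x)) * exp (-(Real.pi * x)) := by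
      rw [← exp_add]
      linarith [add_one_le_exp (-(Real.pi * x) + -(Real.pi * x))]
    have h7 : exp (-(Real.pi * x)) * exp (Real.pi * x) = 1 := by rw [← exp_add]; simp
    have h8 : exp (-(Real.pi * x)) * exp (-(Real.pi * x)) * exp (Real.pi * x) = exp (-(Real.pi * x)) := by
      rw [mul_assoc, h7, mul_one]
    rw [sinh_eq]
    nlinarith [mul_le_mul_of_nonneg_right h6 (exp_pos (Real.pi * x)).le]
  exact le_of_mul_le_mul_left (h4.trans h5) hpx

/-- For `|t| ≤ 1` the product is at most `exp(πN|t|) ≤ exp(m|t|)`, and `log(1+|t|) ≥ |t|/2`. For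
`|t| ≥ 1`, extracting `t²` from each factor leaves at most `e^(πN) ≤ 2^(8N)`, so the total is at
most `(1+|t|)^(2N+8N)`; hence the `5`. -/
theorem prod_one_add_sq_le_one_add_abs_pow {m N : ℕ} (hN : 5 * N ≤ m) (t : ℝ) :
    ∏ j ∈ Finset.range N, (1 + ((N : ℝ) / ((j : ℝ) + 1)) ^ 2 * t ^ 2) ≤
      ((1 + |t|) ^ m) ^ 2 := by
  have hN' : 5 * (N : ℝ) ≤ m := by exact_mod_cast hN
  rcases le_total |t| 1 with ht | ht
  · have h1 := Real.prod_one_add_sq_div_le_exp N (x := N * |t|) (by positivity)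
    have h2 : ∏ j ∈ Finset.range N, (1 + ((N : ℝ) / ((j : ℝ) + 1)) ^ 2 * t ^ 2) =
        ∏ j ∈ Finset.range N, (1 + (N * |t|) ^ 2 / ((j : ℝ) + 1) ^ 2) :=
      Finset.prod_congr rfl fun j _ => by rw [mul_pow, sq_abs, div_pow]; ring
    rw [h2]
    refine h1.trans ?_
    have h3 : 0 < 1 + |t| := by positivity
    rw [← pow_mul, ← Real.exp_log (pow_pos h3 _), Real.log_pow]
    refine Real.exp_le_exp.2 ?_
    have h4 := Real.one_sub_inv_le_log_of_pos h3
    have h5 : |t| / 2 ≤ 1 - (1 + |t|)⁻¹ := by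
      have : 1 - (1 + |t|)⁻¹ = |t| / (1 + |t|) := by field_simp; ring
      rw [this]
      exact div_le_div_of_nonneg_left (abs_nonneg t) h3 (by linarith)
    have h6 : Real.pi * (N * |t|) ≤ m * |t| := by
      rw [← mul_assoc]
      refine mul_le_mul_of_nonneg_right ?_ (abs_nonneg t)
      nlinarith [Real.pi_lt_four, (Nat.cast_nonneg N : (0 : ℝ) ≤ N)]
    have h7 : (m : ℝ) * (|t| / 2) ≤ m * Real.log (1 + |t|) := by gcongr; linarith
    push_cast
    linarith
  · have h1 := Real.prod_one_add_sq_div_le_exp N (x := N) (by positivity)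
    have h2 : ∏ j ∈ Finset.range N, (1 + ((N : ℝ) / ((j : ℝ) + 1)) ^ 2 * t ^ 2) ≤
        ∏ j ∈ Finset.range N, (t ^ 2 * (1 + (N : ℝ) ^ 2 / ((j : ℝ) + 1) ^ 2)) := by
      refine Finset.prod_le_prod (fun j _ => by positivity) fun j _ => ?_
      rw [div_pow]
      nlinarith [(one_le_sq_iff_one_le_abs t).2 ht]
    rw [Finset.prod_mul_distrib, Finset.prod_const, Finset.card_range] at h2
    have h3 : Real.exp (Real.pi * N) ≤ 256 ^ N := by
      rw [mul_comm, Real.exp_nat_mul]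
      refine pow_le_pow_left₀ (Real.exp_pos _).le ?_ N
      calc Real.exp Real.pi ≤ Real.exp ((4 : ℕ) * 1) :=
            Real.exp_le_exp.2 (by norm_num; exact Real.pi_le_four)
        _ = Real.exp 1 ^ 4 := Real.exp_nat_mul 1 4
        _ ≤ 3 ^ 4 := pow_le_pow_left₀ (Real.exp_pos _).le
            (Real.exp_one_lt_d9.le.trans (by norm_num)) 4
        _ ≤ 256 := by norm_num
    calc _ ≤ (t ^ 2) ^ N * ∏ j ∈ Finset.range N, (1 + (N : ℝ) ^ 2 / ((j : ℝ) + 1) ^ 2) := h2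
      _ ≤ (t ^ 2) ^ N * 256 ^ N := by gcongr; exact h1.trans h3
      _ = (|t| ^ 2) ^ N * ((1 + 1) ^ (4 * N)) ^ 2 := by
        rw [sq_abs, ← pow_mul (1 + 1 : ℝ), mul_right_comm, pow_mul (1 + 1 : ℝ)]; norm_num
      _ ≤ ((1 + |t|) ^ 2) ^ N * ((1 + |t|) ^ (4 * N)) ^ 2 := by gcongr; linarith
      _ = ((1 + |t|) ^ (5 * N)) ^ 2 := by simp only [← pow_mul, ← pow_add]; ring_nf
      _ ≤ ((1 + |t|) ^ m) ^ 2 := by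
        gcongr
        linarith

theorem natCast_le_harrisConst (m : ℕ) : (m : ℝ) ≤ harrisConst m := by
  have h : ∀ t : ℝ, |(Polynomial.C (m : ℝ) * Polynomial.X).eval t| ≤ (1 + |t|) ^ m := fun t => by
    have := one_add_mul_le_pow (a := |t|) (by linarith [abs_nonneg t]) m
    simp only [Polynomial.eval_mul, Polynomial.eval_C, Polynomial.eval_X, abs_mul, Nat.abs_cast]
    linarith
  simpa using Polynomial.abs_eval_zero_derivative_le_harrisConst h

theorem mul_log_succ_le_harrisConst {m N : ℕ} (hN : 5 * N ≤ m) :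
    N * Real.log (N + 1) ≤ harrisConst m := by
  obtain ⟨A, B, h1, -, h3⟩ := Polynomial.exists_sq_add_sq_eq_prod (Finset.range N)
    fun j => (N : ℝ) / ((j : ℝ) + 1)
  have h4 : ∀ t : ℝ, |B.eval t| ≤ (1 + |t|) ^ m := fun t =>
    abs_le_of_sq_le_sq ((le_add_of_nonneg_left (sq_nonneg (A.eval t))).trans
      ((h1 t).trans_le (prod_one_add_sq_le_one_add_abs_pow hN t))) (by positivity)
  refine le_trans ?_ ((le_abs_self _).trans
    (Polynomial.abs_eval_zero_derivative_le_harrisConst h4))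
  have h5 := log_add_one_le_harmonic N
  rw [h3]
  simp only [div_eq_mul_inv]
  rw [← Finset.mul_sum]
  refine mul_le_mul_of_nonneg_left ?_ (Nat.cast_nonneg N)
  simpa [harmonic] using h5

theorem mul_log_le_harrisConst {m : ℕ} (hm : 2 ≤ m) :
    1 / 25 * (m * Real.log m) ≤ harrisConst m := by
  have hm' : (2 : ℝ) ≤ m := by exact_mod_cast hm
  have hlog : 0 ≤ Real.log m := Real.log_nonneg (by linarith)
  -- Up to `25`, the polynomial `m t` suffices since `log m ≤ 25`. Beyond, `N = ⌊m/5⌋` satisfies `N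
  -- ≥ m/10` and `m ≤ (N+1)²`.
  rcases le_total m 25 with h | h
  · have h' : (m : ℝ) ≤ 25 := by exact_mod_cast h
    have h1 := Real.log_le_sub_one_of_pos (by linarith : (0 : ℝ) < m)
    have h2 := natCast_le_harrisConst m
    nlinarith
  · have h' : (25 : ℝ) ≤ m := by exact_mod_cast h
    have h1 := mul_log_succ_le_harrisConst (Nat.mul_div_le m 5)
    have h2 : (m : ℝ) ≤ 5 * (m / 5 : ℕ) + 4 := by
      exact_mod_cast (by omega : m ≤ 5 * (m / 5) + 4)
    have h3 : Real.log m ≤ 2 * Real.log ((m / 5 : ℕ) + 1) := by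
      rw [← Real.log_rpow (by positivity)]
      refine Real.log_le_log (by linarith) ?_
      norm_cast
      have : 5 ≤ m / 5 + 1 := by omega
      have : m ≤ 5 * (m / 5 + 1) := by omega
      nlinarith
    have h4 : (m : ℝ) / 10 * (Real.log m / 2) ≤ (m / 5 : ℕ) * Real.log ((m / 5 : ℕ) + 1) :=
      mul_le_mul (by linarith) (by linarith) (by linarith) (Nat.cast_nonneg _)
    nlinarith [mul_nonneg (by linarith : (0 : ℝ) ≤ m) hlog]

/-! ### A product formula from Chebyshev polynomials -/

namespace Polynomial

theorem Chebyshev.eval_T_add_div_two (n : ℕ) {y z : ℝ} (h : y * z = 1) :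
    (Chebyshev.T ℝ n).eval ((y + z) / 2) = (y ^ n + z ^ n) / 2 := by
  induction n using Nat.twoStepInduction with
  | zero => simp
  | one => simp
  | more n h1 h2 =>
    have h3 : ((n + 2 : ℕ) : ℤ) = (n : ℤ) + 2 := by push_cast; rfl
    push_cast at h2
    rw [h3, Chebyshev.T_add_two, eval_sub, eval_mul, eval_mul, h1, h2]
    simp only [eval_ofNat, eval_X]
    linear_combination (y ^ n + z ^ n) / 2 * h

theorem Chebyshev.eval_T_eq_prod (n : ℕ) (u : ℝ) :
    (Chebyshev.T ℝ n).eval u = (Chebyshev.T ℝ n).leadingCoeff *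
      ∏ k ∈ Finset.range n, (u - Real.cos ((2 * k + 1) * Real.pi / (2 * n))) := by
  have hinj := (Finset.range n).nodup_map_iff_injOn.1 (Chebyshev.roots_T_real_nodup n)
  have hroots := Chebyshev.roots_T_real n
  have hs : (Chebyshev.T ℝ n).Splits := by
    rw [splits_iff_card_roots, hroots]
    change (Finset.image _ _).card = _
    rw [Finset.card_image_of_injOn hinj, Chebyshev.natDegree_T]
    simp
  rw [hs.eval_eq_prod_roots, hroots]
  congr 1
  change ∏ v ∈ Finset.image _ _, (u - v) = _
  rw [Finset.prod_image hinj]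

end Polynomial

/-- The angles `(2k+1)π/(4m)`. -/
noncomputable def nodeAngle (m k : ℕ) : ℝ := (2 * k + 1) * Real.pi / (4 * m)

theorem nodeAngle_pos {m k : ℕ} (hk : k < m) : 0 < nodeAngle m k := by
  have : (0 : ℝ) < m := by exact_mod_cast (Nat.zero_le k).trans_lt hk
  unfold nodeAngle
  positivity

theorem nodeAngle_lt {m k : ℕ} (hk : k < m) : nodeAngle m k < Real.pi / 2 := by
  have h0 : (0 : ℝ) < m := by exact_mod_cast (Nat.zero_le k).trans_lt hk
  have h1 : (k : ℝ) + 1 ≤ m := by exact_mod_cast hk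
  unfold nodeAngle
  rw [div_lt_div_iff₀ (by positivity) (by norm_num)]
  nlinarith [Real.pi_pos]

/-- Factor `T_m` at `(y + 1/y)/2` with `y = (1+x)/(1-x)`. Its zeros are `cos 2θ_k`, each factor is a
multiple of `1 + cot²θ_k x²`, and `T_m(1) = 1` fixes the constant. The points `x = ±1` follow by
density. -/
theorem prod_one_add_inv_tan_sq {m : ℕ} (x : ℝ) :
    ∏ k ∈ Finset.range m, (1 + (Real.tan (nodeAngle m k))⁻¹ ^ 2 * x ^ 2) =
      ((1 + x) ^ (2 * m) + (1 - x) ^ (2 * m)) / 2 := by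
  have key : ∀ x : ℝ, x ∈ ({1, -1} : Set ℝ)ᶜ →
      ∏ k ∈ Finset.range m, (1 + (Real.tan (nodeAngle m k))⁻¹ ^ 2 * x ^ 2) =
        ((1 + x) ^ (2 * m) + (1 - x) ^ (2 * m)) / 2 := by
    intro x hx
    simp only [Set.mem_compl_iff, Set.mem_insert_iff, Set.mem_singleton_iff, not_or] at hx
    have h1 : 1 - x ≠ 0 := fun h => hx.1 (by linarith)
    have h2 : 1 + x ≠ 0 := fun h => hx.2 (by linarith)
    have h12 : 1 - x ^ 2 ≠ 0 := by
      rw [show 1 - x ^ 2 = (1 - x) * (1 + x) by ring]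
      exact mul_ne_zero h1 h2
    have e1 := Polynomial.Chebyshev.eval_T_add_div_two m
      (y := (1 + x) / (1 - x)) (z := (1 - x) / (1 + x)) (by field_simp)
    have e2 := Polynomial.Chebyshev.eval_T_add_div_two m (y := 1) (z := 1) (by norm_num)
    rw [Polynomial.Chebyshev.eval_T_eq_prod] at e1 e2
    have e3 : ∏ k ∈ Finset.range m, (((1 + x) / (1 - x) + (1 - x) / (1 + x)) / 2 -
        Real.cos ((2 * k + 1) * Real.pi / (2 * m))) =
        (∏ k ∈ Finset.range m, (1 - Real.cos ((2 * k + 1) * Real.pi / (2 * m)))) *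
        ((∏ k ∈ Finset.range m, (1 + (Real.tan (nodeAngle m k))⁻¹ ^ 2 * x ^ 2)) /
          (1 - x ^ 2) ^ m) := by
      rw [show (1 - x ^ 2) ^ m = ∏ _k ∈ Finset.range m, (1 - x ^ 2) by simp,
        ← Finset.prod_div_distrib, ← Finset.prod_mul_distrib]
      refine Finset.prod_congr rfl fun k hk => ?_
      have hk := Finset.mem_range.1 hk
      have hs : Real.sin (nodeAngle m k) ≠ 0 := (Real.sin_pos_of_pos_of_lt_pi (nodeAngle_pos hk)
        (by linarith [nodeAngle_lt hk, Real.pi_pos])).ne'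
      have h3 : (2 * (k : ℝ) + 1) * Real.pi / (2 * m) = 2 * nodeAngle m k := by
        unfold nodeAngle; ring
      rw [h3, Real.cos_two_mul, Real.tan_eq_sin_div_cos, inv_div]
      have h4 := Real.sin_sq_add_cos_sq (nodeAngle m k)
      have h5 : Real.cos (nodeAngle m k) ^ 2 = 1 - Real.sin (nodeAngle m k) ^ 2 := by linarith
      rw [div_pow, h5, div_add_div _ _ h1 h2,
        show (1 - x) * (1 + x) = 1 - x ^ 2 by ring]
      field_simp
      ring
    have e4 : ((1 : ℝ) + 1) / 2 = 1 := by norm_num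
    rw [e4] at e2
    rw [e3, ← mul_assoc, e2, one_pow, e4, one_mul, div_eq_iff (pow_ne_zero m h12)] at e1
    rw [e1, div_pow, div_pow, show 1 - x ^ 2 = (1 - x) * (1 + x) by ring, mul_pow]
    have := pow_ne_zero m h1
    have := pow_ne_zero m h2
    field_simp
    ring
  refine congrFun (Continuous.ext_on (s := ({1, -1} : Set ℝ)ᶜ)
    ((Set.toFinite _).countable.dense_compl ℝ) (by fun_prop) (by fun_prop) key) x

/-- Adding the nonnegative `(1-|x|)^(2m)` turns the weight into a polynomial, at the cost of a
factor `2`. -/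
theorem one_add_abs_pow_sq_le (m : ℕ) (x : ℝ) :
    ((1 + |x|) ^ m) ^ 2 ≤
      2 * ∏ k ∈ Finset.range m, (1 + (Real.tan (nodeAngle m k))⁻¹ ^ 2 * x ^ 2) := by
  have h := prod_one_add_inv_tan_sq (m := m) |x|
  rw [sq_abs] at h
  rw [h, ← pow_mul, mul_comm m 2]
  have : 0 ≤ (1 - |x|) ^ (2 * m) := (even_two_mul m).pow_nonneg _
  linarith

/-! ### Bernstein inequality for a majorant with zeros in the lower half-plane -/

section Majorant

open Complex Polynomial

/-- The polynomial `∏_{k<m} (1 - i a_k z)`. -/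
noncomputable def lowerPoly (a : ℕ → ℝ) (m : ℕ) : Polynomial ℂ :=
  ∏ k ∈ Finset.range m, (1 - C (I * a k) * X)

variable {a : ℕ → ℝ} {m : ℕ}

theorem eval_lowerPoly (a : ℕ → ℝ) (m : ℕ) (z : ℂ) :
    (lowerPoly a m).eval z = ∏ k ∈ Finset.range m, (1 - I * a k * z) := by
  simp [lowerPoly, eval_prod]

theorem eval_zero_derivative_lowerPoly (a : ℕ → ℝ) (m : ℕ) :
    (lowerPoly a m).derivative.eval 0 = -(I * (∑ k ∈ Finset.range m, a k : ℝ)) := by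
  induction m with
  | zero => simp [lowerPoly]
  | succ m ih =>
    have h1 : lowerPoly a (m + 1) = lowerPoly a m * (1 - C (I * a m) * X) := by
      simp [lowerPoly, Finset.prod_range_succ]
    have h2 : (lowerPoly a m).eval 0 = 1 := by simp [eval_lowerPoly]
    rw [h1, derivative_mul, eval_add, eval_mul, eval_mul, ih, h2, Finset.sum_range_succ]
    simp
    ring

theorem norm_eval_lowerPoly_ofReal_sq (a : ℕ → ℝ) (m : ℕ) (x : ℝ) :
    ‖(lowerPoly a m).eval (x : ℂ)‖ ^ 2 = ∏ k ∈ Finset.range m, (1 + a k ^ 2 * x ^ 2) := by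
  rw [eval_lowerPoly, norm_prod, ← Finset.prod_pow]
  refine Finset.prod_congr rfl fun k _ => ?_
  rw [← normSq_eq_norm_sq, normSq_apply]
  simp
  ring

theorem one_le_norm_eval_lowerPoly (ha : ∀ k < m, 0 < a k) {z : ℂ} (hz : 0 ≤ z.im) :
    1 ≤ ‖(lowerPoly a m).eval z‖ := by
  rw [eval_lowerPoly, norm_prod]
  refine Finset.one_le_prod fun k hk => ?_
  refine le_trans ?_ (re_le_norm _)
  simpa using mul_nonneg (ha k (Finset.mem_range.1 hk)).le hz

theorem norm_eval_lowerPoly_I_mul (ha : ∀ k < m, 0 < a k) {y : ℝ} (hy : 0 ≤ y) :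
    ‖(lowerPoly a m).eval (I * y)‖ = ∏ k ∈ Finset.range m, (1 + a k * y) := by
  rw [eval_lowerPoly, norm_prod]
  refine Finset.prod_congr rfl fun k hk => ?_
  have h1 : 1 - I * a k * (I * y) = ((1 + a k * y : ℝ) : ℂ) := by
    push_cast
    linear_combination -(a k : ℂ) * y * I_sq
  have := (ha k (Finset.mem_range.1 hk)).le
  rw [h1, norm_real, Real.norm_of_nonneg (by positivity)]

theorem Polynomial.exists_norm_eval_le {p : Polynomial ℂ} (hp : p.natDegree ≤ m) :
    ∃ K : ℝ, 0 ≤ K ∧ ∀ z : ℂ, ‖p.eval z‖ ≤ K * (1 + ‖z‖) ^ m := by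
  refine ⟨∑ i ∈ Finset.range (m + 1), ‖p.coeff i‖,
    Finset.sum_nonneg fun _ _ => norm_nonneg _, fun z => ?_⟩
  rw [eval_eq_sum_range' (n := m + 1) (by omega), Finset.sum_mul]
  refine (norm_sum_le _ _).trans (Finset.sum_le_sum fun i hi => ?_)
  rw [norm_mul, norm_pow]
  have h1 : i ≤ m := Nat.lt_succ_iff.1 (Finset.mem_range.1 hi)
  have h2 : ‖z‖ ^ i ≤ (1 + ‖z‖) ^ m :=
    (pow_le_pow_left₀ (norm_nonneg z) (by linarith) i).trans
      (pow_le_pow_right₀ (by linarith [norm_nonneg z]) h1)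
  gcongr

open Filter Asymptotics in
/-- A polynomial bound by `lowerPoly` on the real line extends to the upper half-plane. -/
theorem norm_eval_le_of_im_nonneg (ha : ∀ k < m, 0 < a k) {p : Polynomial ℂ}
    (hp : p.natDegree ≤ m) {c : ℝ}
    (h : ∀ x : ℝ, ‖p.eval (x : ℂ)‖ ≤ c * ‖(lowerPoly a m).eval (x : ℂ)‖)
    {z : ℂ} (hz : 0 ≤ z.im) : ‖p.eval z‖ ≤ c * ‖(lowerPoly a m).eval z‖ := by
  obtain ⟨K, hK0, hK⟩ := exists_norm_eval_le hp
  have him : ∀ {w : ℂ}, 0 ≤ w.re → 0 ≤ (I * w).im := fun hw => by simpa using hw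
  have hone : ∀ {w : ℂ}, 0 ≤ w.re → 1 ≤ ‖(lowerPoly a m).eval (I * w)‖ := fun hw =>
    one_le_norm_eval_lowerPoly ha (him hw)
  -- The quotient, rotated to the right half-plane for Phragmén–Lindelöf.
  let f : ℂ → ℂ := fun w => p.eval (I * w) / (lowerPoly a m).eval (I * w)
  have hf : ∀ {w : ℂ}, 0 ≤ w.re → ‖f w‖ ≤ K * (1 + ‖w‖) ^ m := fun {w} hw => by
    have h1 := hK (I * w)
    rw [norm_mul, norm_I, one_mul] at h1
    rw [norm_div]
    exact (div_le_self (norm_nonneg _) (hone hw)).trans h1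
  have hd : DiffContOnCl ℂ f {w | 0 < w.re} := by
    refine DifferentiableOn.diffContOnCl fun w hw => ?_
    have hw' : 0 ≤ w.re := closure_minimal (t := {v : ℂ | 0 ≤ v.re})
      (fun v (hv : 0 < v.re) => hv.le) (isClosed_le continuous_const continuous_re) hw
    refine (DifferentiableAt.div ?_ ?_ ?_).differentiableWithinAt
    · exact p.differentiable.differentiableAt.comp w (by fun_prop)
    · exact (lowerPoly a m).differentiable.differentiableAt.comp w (by fun_prop)
    · exact norm_pos_iff.1 (zero_lt_one.trans_le (hone hw'))
  have hexp : ∃ r < (2 : ℝ), ∃ B, f =O[Bornology.cobounded ℂ ⊓ 𝓟 {w | 0 < w.re}]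
      fun w => Real.exp (B * ‖w‖ ^ r) := by
    refine ⟨1, by norm_num, m, IsBigO.of_bound K ?_⟩
    refine eventually_inf_principal.2 (Eventually.of_forall fun w (hw : 0 < w.re) => ?_)
    rw [Real.norm_of_nonneg (Real.exp_pos _).le, Real.rpow_one, Real.exp_nat_mul]
    refine (hf hw.le).trans ?_
    gcongr
    linarith [Real.add_one_le_exp ‖w‖]
  -- On the positive axis the denominator `∏ (1 + a_k x)` is at least a constant times `(1 + x)^m`,
  -- which absorbs the growth of `p`.
  have hre : IsBoundedUnder (· ≤ ·) atTop fun x : ℝ => ‖f x‖ := by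
    have hD : 0 < ∏ k ∈ Finset.range m, min 1 (a k) := Finset.prod_pos fun k hk =>
      lt_min one_pos (ha k (Finset.mem_range.1 hk))
    refine ⟨K / ∏ k ∈ Finset.range m, min 1 (a k),
      eventually_map.2 ((eventually_ge_atTop 0).mono fun x hx => ?_)⟩
    have h1 := hK (I * x)
    rw [norm_mul, norm_I, one_mul, norm_real, Real.norm_of_nonneg hx] at h1
    have h2 : (∏ k ∈ Finset.range m, min 1 (a k)) * (1 + x) ^ m ≤
        ‖(lowerPoly a m).eval (I * x)‖ := by
      rw [norm_eval_lowerPoly_I_mul ha hx,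
        show (1 + x) ^ m = ∏ _k ∈ Finset.range m, (1 + x) by simp, ← Finset.prod_mul_distrib]
      refine Finset.prod_le_prod (fun k hk => ?_) fun k hk => ?_
      · have := (lt_min one_pos (ha k (Finset.mem_range.1 hk))).le
        positivity
      · nlinarith [min_le_left 1 (a k), min_le_right 1 (a k)]
    change ‖f x‖ ≤ _
    rw [norm_div, div_le_div_iff₀ (zero_lt_one.trans_le (hone (w := x) (by simpa using hx))) hD]
    calc _ ≤ K * (1 + x) ^ m * ∏ k ∈ Finset.range m, min 1 (a k) := by gcongr
      _ = K * ((∏ k ∈ Finset.range m, min 1 (a k)) * (1 + x) ^ m) := by ring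
      _ ≤ _ := by gcongr
  have hbd : ∀ x : ℝ, ‖f (x * I)‖ ≤ c := fun x => by
    have h1 : I * (x * I) = ((-x : ℝ) : ℂ) := by
      push_cast
      linear_combination (x : ℂ) * I_sq
    have h2 := hone (w := x * I) (by simp)
    simp only [f, norm_div]
    rw [div_le_iff₀ (zero_lt_one.trans_le h2), h1]
    exact h (-x)
  have hzw : I * (-I * z) = z := by linear_combination -z * I_sq
  have h3 := PhragmenLindelof.right_half_plane_of_bounded_on_real hd hexp hre hbd
    (z := -I * z) (by simpa using hz)
  simp only [f, norm_div, hzw] at h3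
  rwa [div_le_iff₀ (zero_lt_one.trans_le (one_le_norm_eval_lowerPoly ha hz))] at h3

/-- A Bernstein inequality of de Bruijn type at the origin. -/
theorem norm_eval_zero_derivative_le (hm : 0 < m) (ha : ∀ k < m, 0 < a k) {p : Polynomial ℂ}
    (hp : p.natDegree ≤ m) {c : ℝ}
    (h : ∀ x : ℝ, ‖p.eval (x : ℂ)‖ ≤ c * ‖(lowerPoly a m).eval (x : ℂ)‖) :
    ‖p.derivative.eval 0‖ ≤ c * ∑ k ∈ Finset.range m, a k := by
  by_contra! hlt
  set h₀ := lowerPoly a m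
  have hsum : 0 < ∑ k ∈ Finset.range m, a k := Finset.sum_pos
    (fun k hk => ha k (Finset.mem_range.1 hk)) ⟨0, Finset.mem_range.2 hm⟩
  have hd0 : ‖h₀.derivative.eval 0‖ = ∑ k ∈ Finset.range m, a k := by
    rw [eval_zero_derivative_lowerPoly, norm_neg, norm_mul, norm_I, one_mul, norm_real,
      Real.norm_of_nonneg hsum.le]
  -- With this `μ`, the origin is a critical point of `q = p - μ h₀`. Since `|μ| > c`, all zeros of
  -- `q` lie in the open lower half-plane, contradicting Gauss–Lucas.
  set μ := p.derivative.eval 0 / h₀.derivative.eval 0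
  have hμ : c < ‖μ‖ := by
    rw [norm_div, hd0, lt_div_iff₀ hsum]
    exact hlt
  set q := p - C μ * h₀
  have hq : ∀ {z : ℂ}, 0 ≤ z.im → (‖μ‖ - c) * ‖h₀.eval z‖ ≤ ‖q.eval z‖ := fun {z} hz => by
    have h1 := norm_eval_le_of_im_nonneg ha hp h hz
    have h2 : ‖C μ * h₀ |>.eval z‖ = ‖μ‖ * ‖h₀.eval z‖ := by simp
    have h3 := norm_sub_norm_le ((C μ * h₀).eval z) (p.eval z)
    rw [norm_sub_rev, h2, ← eval_sub] at h3
    linarith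
  have hroots : q.rootSet ℂ ⊆ {z | z.im < 0} := fun z hz => by
    by_contra hz'
    have h1 := hq (not_lt.1 hz')
    have h2 : q.eval z = 0 := by simpa using (mem_rootSet.1 hz).2
    have h3 := one_le_norm_eval_lowerPoly ha (not_lt.1 hz')
    rw [h2, norm_zero] at h1
    nlinarith
  have hdeg : 0 < q.degree := by
    by_contra! hdeg
    obtain ⟨b, hb⟩ : ∃ b, q = C b := ⟨_, eq_C_of_degree_le_zero hdeg⟩
    have ha0 := ha 0 hm
    have hcμ : 0 < ‖μ‖ - c := by linarith
    -- At height `y` equal to this quotient, `(|μ| - c)(1 + a_0 y) = |μ| - c + |b|` exceeds `|b|`,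
    -- so `q` is not constant.
    have hy : 0 ≤ ‖b‖ / ((‖μ‖ - c) * a 0) := by positivity
    have h1 := hq (z := I * (‖b‖ / ((‖μ‖ - c) * a 0) : ℝ)) (by simpa only [I_mul_im, ofReal_re] using hy)
    rw [norm_eval_lowerPoly_I_mul ha hy, hb, eval_C] at h1
    have h2 : 1 + a 0 * (‖b‖ / ((‖μ‖ - c) * a 0)) ≤
        ∏ k ∈ Finset.range m, (1 + a k * (‖b‖ / ((‖μ‖ - c) * a 0))) := by
      rw [← Finset.mul_prod_erase _ _ (Finset.mem_range.2 hm)]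
      refine le_mul_of_one_le_right (by positivity) (Finset.one_le_prod fun k hk => ?_)
      have := ha k (Finset.mem_range.1 (Finset.mem_of_mem_erase hk))
      have : 0 ≤ a k * (‖b‖ / ((‖μ‖ - c) * a 0)) := by positivity
      linarith
    have h3 : (‖μ‖ - c) * (1 + a 0 * (‖b‖ / ((‖μ‖ - c) * a 0))) = (‖μ‖ - c) + ‖b‖ := by
      field_simp
    nlinarith
  have hd' : h₀.derivative.eval 0 ≠ 0 := norm_pos_iff.1 (hd0 ▸ hsum)
  have hq0 : q.derivative.eval 0 = 0 := by
    simp [q, μ, div_mul_cancel₀ _ hd']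
  have hne : q.derivative ≠ 0 := fun h0 =>
    (natDegree_pos_iff_degree_pos.2 hdeg).ne' (derivative_eq_zero.1 h0)
  have hmem : (0 : ℂ) ∈ q.derivative.rootSet ℂ := mem_rootSet.2 ⟨hne, by simpa using hq0⟩
  have h5 := convexHull_min hroots (convex_halfSpace_im_lt 0)
    (rootSet_derivative_subset_convexHull_rootSet hdeg hmem)
  simp at h5

end Majorant

/-! ### Upper bound with the constant `3` -/

theorem harrisConst_le_sum_inv_tan {m : ℕ} (hm : 0 < m) :
    harrisConst m ≤ √2 * ∑ k ∈ Finset.range m, (Real.tan (nodeAngle m k))⁻¹ := by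
  obtain ⟨p, hp, h⟩ := (isGreatest_harrisConst m).1
  have ha : ∀ k < m, 0 < (Real.tan (nodeAngle m k))⁻¹ := fun k hk =>
    inv_pos.2 (Real.tan_pos_of_pos_of_lt_pi_div_two (nodeAngle_pos hk) (nodeAngle_lt hk))
  have h1 := norm_eval_zero_derivative_le hm ha (p := p.map Complex.ofRealHom)
    (Polynomial.natDegree_map_le.trans (Polynomial.natDegree_le_of_abs_eval_le hp))
    (c := √2) fun x => by
      have h2 : (p.map Complex.ofRealHom).eval (x : ℂ) = ((p.eval x : ℝ) : ℂ) := by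
        rw [← Complex.ofRealHom_eq_coe, Polynomial.eval_map_apply]; rfl
      rw [h2, Complex.norm_real, Real.norm_eq_abs]
      refine abs_le_of_sq_le_sq ?_ (by positivity)
      rw [mul_pow, norm_eval_lowerPoly_ofReal_sq, Real.sq_sqrt (by norm_num), ← sq_abs]
      exact (pow_le_pow_left₀ (abs_nonneg _) (hp x) 2).trans (one_add_abs_pow_sq_le m x)
  rw [h]
  convert h1 using 1
  rw [Polynomial.derivative_map, Polynomial.eval_zero_map, Complex.ofRealHom_eq_coe,
    Complex.norm_real, Real.norm_eq_abs]

/-- Each new term is at most half the increment of `log(2m-1)`. Starting at `m = 3`, with `1 + 1/3 +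
1/5 = 23/15`, keeps the constant small enough for the factor `3`. -/
theorem sum_inv_odd_le {m : ℕ} (hm : 3 ≤ m) :
    ∑ k ∈ Finset.range m, (2 * (k : ℝ) + 1)⁻¹ ≤ 23 / 15 + Real.log ((2 * m - 1) / 5) / 2 := by
  induction m, hm using Nat.le_induction with
  | base => norm_num [Finset.sum_range_succ]
  | succ m hm ih =>
    have hm' : (3 : ℝ) ≤ m := by exact_mod_cast hm
    have h0 : (0 : ℝ) < 2 * m - 1 := by linarith
    have h1 : 0 < (2 * (m : ℝ) + 1) / (2 * m - 1) := by positivity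
    have h2 := Real.one_sub_inv_le_log_of_pos h1
    have h3 : (2 * ((m + 1 : ℕ) : ℝ) - 1) / 5 =
        (2 * m - 1) / 5 * ((2 * (m : ℝ) + 1) / (2 * m - 1)) := by
      push_cast
      field_simp
      ring
    rw [Finset.sum_range_succ, h3, Real.log_mul (by positivity) h1.ne']
    have h4 : 1 - ((2 * (m : ℝ) + 1) / (2 * m - 1))⁻¹ = 2 * (2 * (m : ℝ) + 1)⁻¹ := by
      field_simp
      ring
    linarith

/-- For degree at most `2`, `p'(0) = (p(1) - p(-1))/2`. -/
theorem harrisConst_two_le : harrisConst 2 ≤ 4 := by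
  obtain ⟨p, hp, h⟩ := (isGreatest_harrisConst 2).1
  have hd := Polynomial.natDegree_le_of_abs_eval_le hp
  have h1 := hp 1
  have h2 := hp (-1)
  rw [Polynomial.eval_eq_sum_range' (n := 3) (by omega)] at h1 h2
  rw [h, Polynomial.eval_zero_derivative]
  norm_num [Finset.sum_range_succ] at h1 h2
  rw [abs_le] at h1 h2 ⊢
  constructor <;> linarith

theorem harrisConst_le_mul_log {m : ℕ} (hm : 2 ≤ m) :
    harrisConst m ≤ 3 * (m * Real.log m) := by
  -- The general estimate needs `log m` above about `1.058`, which fails at `m = 2`.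
  rcases hm.eq_or_lt with rfl | hm
  · have := Real.log_two_gt_d9
    push_cast
    linarith [harrisConst_two_le]
  have hm' : (3 : ℝ) ≤ m := by exact_mod_cast hm
  have h1 : ∑ k ∈ Finset.range m, (Real.tan (nodeAngle m k))⁻¹ ≤
      4 * m / Real.pi * ∑ k ∈ Finset.range m, (2 * (k : ℝ) + 1)⁻¹ := by
    rw [Finset.mul_sum]
    refine Finset.sum_le_sum fun k hk => ?_
    have hk := Finset.mem_range.1 hk
    refine (inv_anti₀ (nodeAngle_pos hk)
      (Real.lt_tan (nodeAngle_pos hk) (nodeAngle_lt hk)).le).trans_eq ?_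
    unfold nodeAngle
    have := Real.pi_pos
    field_simp
  have h2 := sum_inv_odd_le hm
  have h3 : Real.log ((2 * m - 1) / 5) ≤ Real.log m - 3 / 5 := by
    have h4 : Real.log ((2 * m - 1) / 5) ≤ Real.log (m * (2 / 5)) :=
      Real.log_le_log (by linarith) (by linarith)
    rw [Real.log_mul (by positivity) (by norm_num)] at h4
    linarith [Real.log_le_sub_one_of_pos (by norm_num : (0 : ℝ) < 2 / 5)]
  have h4 : (1.06 : ℝ) ≤ Real.log m := by
    have h5 : Real.log 3 ≤ Real.log m := Real.log_le_log (by norm_num) hm'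
    have h6 : 2 * Real.log 3 = 3 * Real.log 2 + Real.log (9 / 8) := by
      rw [Real.log_div (by norm_num) (by norm_num), show (9 : ℝ) = 3 ^ 2 by norm_num,
        show (8 : ℝ) = 2 ^ 3 by norm_num, Real.log_pow, Real.log_pow]
      push_cast
      ring
    have h7 := Real.one_sub_inv_le_log_of_pos (by norm_num : (0 : ℝ) < 9 / 8)
    have := Real.log_two_gt_d9
    norm_num at h7 ⊢
    linarith
  have h5 : √2 * (4 / Real.pi) ≤ 1.801 := by
    have h6 : √2 ≤ 1.41422 := by
      rw [Real.sqrt_le_left (by norm_num)]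
      norm_num
    rw [mul_div_assoc', div_le_iff₀ Real.pi_pos]
    linarith [Real.pi_gt_d6]
  have h6 : ∑ k ∈ Finset.range m, (2 * (k : ℝ) + 1)⁻¹ ≤ 1.2334 + Real.log m / 2 := by
    norm_num
    linarith
  calc harrisConst m ≤ √2 * ∑ k ∈ Finset.range m, (Real.tan (nodeAngle m k))⁻¹ :=
        harrisConst_le_sum_inv_tan (by omega)
    _ ≤ √2 * (4 * m / Real.pi * ∑ k ∈ Finset.range m, (2 * (k : ℝ) + 1)⁻¹) := by gcongr
    _ = √2 * (4 / Real.pi) * m * ∑ k ∈ Finset.range m, (2 * (k : ℝ) + 1)⁻¹ := by ring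
    _ ≤ 1.801 * m * (1.2334 + Real.log m / 2) := by gcongr
    _ ≤ 3 * (m * Real.log m) := by nlinarith

theorem mainTheorem5 :
    (∀ m : ℕ, IsGreatest (harrisValues m) (harrisConst m)) ∧
    (∀ m : ℕ, homogeneousMarkovConst.{u} m = ENNReal.ofReal (harrisConst m)) ∧
    ∃ c₁ : ℝ, 0 < c₁ ∧ ∀ m : ℕ, 2 ≤ m →
      c₁ * (m * Real.log m) ≤ harrisConst m ∧ harrisConst m ≤ 3 * (m * Real.log m) :=
  ⟨isGreatest_harrisConst, homogeneousMarkovConst_eq, 1 / 25, by norm_num, fun _ hm =>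
    ⟨mul_log_le_harrisConst hm, harrisConst_le_mul_log hm⟩⟩
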